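/- Notation. Let $\mathbb D$ be the open unit disk. For $0<p<\infty$, $H^p$ is the space of holomorphic functions $f$ on $\mathbb D$ with $\sup_{0<r<1}\frac1{2\pi}\int_0^{2\pi}|f(re^{i\theta})|^p\,d\theta<\infty$; a power series is said to be in $H^p$ if it converges on $\mathbb D$ and its sum is in $H^p$. A sequence $\{\lambda_n\}_{n\ge0}$ of complex numbers is a coefficient multiplier from $H^2$ to $H^p$, written $\{\lambda_n\}\in(H^2,H^p)$, if $\sum_{n\ge0} a_n\lambda_nz^n\in H^p$ for every $\sum_{n\ge0} a_nz^n\in H^2$. A sequence $\{X_n\}_{n\ge0}$ of real random variables has the L-property if for every $p\in(0,\infty)$ and every $\sum_{n\ge0} a_nz^n\in H^2$ one has $\sum_{n\ge0} a_nX_nz^n\in H^p$ almost surely. Proposition. Let $\{X_n\}_{n=0}^\infty$ be a real centered Gaussian process (its entries need not be independent) with the L-property. Then for every $m\ge0$, $$\{\mathbb E(X_nX_m)\}_{n=0}^\infty\in\bigcap_{1\le p<\infty}(H^2,H^p).$$ Furthermore, for every $m\ge0$ for which the sequence $\{|\mathbb E(X_nX_m)|\}_{n=0}^\infty$ is decreasing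 (not necessarily strictly), one has, for every $\varepsilon>0$, $$\mathbb E(X_nX_m)=o\big(n^{-\frac12+\varepsilon}\big)\qquad(n\to\infty).$$ -/

import Mathlib

open MeasureTheory ProbabilityTheory Filter Asymptotics

/-- Membership of a function on the open unit disk of `ℂ` in the Hardy space `H^p` (for a real
exponent `0 < p < ∞`): `f` is holomorphic on the disk and its integral means
`(1 / 2π) ∫ |f (r e^{iθ})|^p dθ` over `0 ≤ θ ≤ 2π` are bounded for `0 < r < 1`.
(The values of `f` outside the disk are irrelevant.) -/
def MemHardy (p : ℝ) (f : ℂ → ℂ) : Prop :=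
  DifferentiableOn ℂ f (Metric.ball 0 1) ∧
    ∃ C : ℝ, ∀ r ∈ Set.Ioo (0 : ℝ) 1, Real.circleAverage (fun z => ‖f z‖ ^ p) 0 r ≤ C

/-- The power series `∑ c n z^n` represents a function in `H^p`: it converges at every point of the
open unit disk, and its sum belongs to `H^p`. -/
def SeriesMemHardy (p : ℝ) (c : ℕ → ℂ) : Prop :=
  ∃ f : ℂ → ℂ, MemHardy p f ∧
    ∀ z ∈ Metric.ball (0 : ℂ) 1, HasSum (fun n : ℕ => c n * z ^ n) (f z)

/-- `lam` belongs to `(H^q, H^p)`, i.e. it is a coefficient multiplier from `H^q` to `H^p`. -/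
def IsCoeffMultiplier (q p : ℝ) (lam : ℕ → ℂ) : Prop :=
  ∀ a : ℕ → ℂ, SeriesMemHardy q a → SeriesMemHardy p (fun n => a n * lam n)

/-- The `L_p`-property of a sequence of real random variables: for every `∑ a n z^n` in `H^2`, the
randomized series `∑ a n X n z^n` is almost surely in `H^p`. -/
def HasLpProperty {Ω : Type*} [MeasurableSpace Ω] (P : Measure Ω) (X : ℕ → Ω → ℝ) (p : ℝ) : Prop :=
  ∀ a : ℕ → ℂ, SeriesMemHardy 2 a →
    ∀ᵐ ω ∂P, SeriesMemHardy p (fun n => a n * (X n ω : ℂ))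

/-- The L-property: the `L_p`-property for every `0 < p < ∞`. -/
def HasLProperty {Ω : Type*} [MeasurableSpace Ω] (P : Measure Ω) (X : ℕ → Ω → ℝ) : Prop :=
  ∀ p : ℝ, 0 < p → HasLpProperty P X p

/-!
The first assertion rests on a reflection argument. Put `λ n = 𝔼 (X n * X m)` and
`σ² = 𝔼 (X m) ^ 2`. If `σ² = 0`, then `λ = 0`. Otherwise the process `X n - 2 (λ n / σ²) X m` is
centered Gaussian with the same covariances as `X`, hence has the same law
(`ProbabilityTheory.IsGaussianProcess.identDistrib_reflection`). Membership of `∑ a n x n z ^ n` in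
`H^p` is a measurable property of the real sequence `x` (`measurableSet_seriesMemHardy`), so it
holds almost surely for both processes. Subtracting the two series, at one outcome where `X m` does
not vanish, leaves a nonzero multiple of `∑ a n λ n z ^ n` (`seriesMemHardy_covariance`). No
integrability of the random `H^p` norm is needed.

For the decay of a multiplier `λ` with `|λ n|` decreasing (`isLittleO_of_isCoeffMultiplier`), apply
it to the series with coefficients `sign (λ n) (n + 1) ^ (-1/2 - δ)`, which lies in `H^2` by
Parseval (`seriesMemHardy_two_of_summable_sq`). The image `f` has nonnegative coefficients, and at
`r = N / (N + 1)` its value is at least a constant times `N ^ (1/2 - δ) |λ N|`. On the other hand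
Cauchy's formula for `f ^ p` gives `|f r| ^ p ≤ C / (1 - r)`
(`MemHardy.exists_norm_pow_mul_le`), and `p` may be taken as large as desired.
-/

/-! ### Series in Hardy spaces -/

theorem SeriesMemHardy.summable_norm {p : ℝ} {c : ℕ → ℂ} (h : SeriesMemHardy p c) {r : ℝ}
    (hr : r ∈ Set.Ioo (0 : ℝ) 1) : Summable fun n => ‖c n‖ * r ^ n := by
  obtain ⟨f, -, hf⟩ := h
  have hmem : (r : ℂ) ∈ Metric.ball (0 : ℂ) 1 := by
    simpa [abs_of_pos hr.1] using hr.2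
  simpa [abs_of_pos hr.1] using (hf r hmem).summable.norm

theorem norm_coeff_mul_pow_le {c : ℕ → ℂ} {r : ℝ} {z : ℂ} (hz : ‖z‖ ≤ r) (n : ℕ) :
    ‖c n * z ^ n‖ ≤ ‖c n‖ * r ^ n := by
  rw [norm_mul, norm_pow]
  gcongr

theorem hasSum_of_summable_norm_Ioo {c : ℕ → ℂ}
    (hc : ∀ r ∈ Set.Ioo (0 : ℝ) 1, Summable fun n => ‖c n‖ * r ^ n) {z : ℂ}
    (hz : z ∈ Metric.ball (0 : ℂ) 1) :
    HasSum (fun n => c n * z ^ n) (∑' n, c n * z ^ n) := by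
  rw [mem_ball_zero_iff] at hz
  obtain ⟨r, hzr, hr1⟩ := exists_between hz
  exact (Summable.of_norm_bounded (hc r ⟨(norm_nonneg z).trans_lt hzr, hr1⟩)
    (norm_coeff_mul_pow_le hzr.le)).hasSum

theorem differentiableOn_tsum_coeff_mul_pow {c : ℕ → ℂ}
    (hc : ∀ r ∈ Set.Ioo (0 : ℝ) 1, Summable fun n => ‖c n‖ * r ^ n) :
    DifferentiableOn ℂ (fun z => ∑' n, c n * z ^ n) (Metric.ball 0 1) := by
  intro z hz
  rw [mem_ball_zero_iff] at hz
  obtain ⟨r, hzr, hr1⟩ := exists_between hz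
  have hd : DifferentiableOn ℂ (fun z => ∑' n, c n * z ^ n) (Metric.ball 0 r) :=
    Complex.differentiableOn_tsum_of_summable_norm
      (hc r ⟨(norm_nonneg z).trans_lt hzr, hr1⟩) (fun n => by fun_prop) Metric.isOpen_ball
      fun n w hw => norm_coeff_mul_pow_le (mem_ball_zero_iff.1 hw).le n
  exact (hd.differentiableAt
    (Metric.isOpen_ball.mem_nhds (mem_ball_zero_iff.2 hzr))).differentiableWithinAt

/-- Only absolute convergence and the integral means matter for membership in `H^p`: holomorphy of
the sum is automatic. -/
theorem seriesMemHardy_iff {p : ℝ} {c : ℕ → ℂ} :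
    SeriesMemHardy p c ↔ (∀ r ∈ Set.Ioo (0 : ℝ) 1, Summable fun n => ‖c n‖ * r ^ n) ∧
      ∃ C : ℝ, ∀ r ∈ Set.Ioo (0 : ℝ) 1,
        Real.circleAverage (fun z => ‖∑' n, c n * z ^ n‖ ^ p) 0 r ≤ C := by
  constructor
  · intro h
    refine ⟨fun r hr => h.summable_norm hr, ?_⟩
    obtain ⟨f, ⟨-, C, hC⟩, hf⟩ := h
    refine ⟨C, fun r hr => ?_⟩
    refine (le_of_eq ?_).trans (hC r hr)
    refine Real.circleAverage_congr_sphere fun z hz => ?_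
    have hz1 : z ∈ Metric.ball (0 : ℂ) 1 := by
      rw [mem_sphere_zero_iff_norm, abs_of_pos hr.1] at hz
      simpa [hz] using hr.2
    simp only [(hf z hz1).tsum_eq]
  · rintro ⟨hc, C, hC⟩
    exact ⟨_, ⟨differentiableOn_tsum_coeff_mul_pow hc, C, hC⟩,
      fun z hz => hasSum_of_summable_norm_Ioo hc hz⟩

theorem continuousOn_norm_rpow {p : ℝ} (hp : 0 ≤ p) {f : ℂ → ℂ} {s : Set ℂ}
    (hf : ContinuousOn f s) : ContinuousOn (fun z => ‖f z‖ ^ p) s :=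
  hf.norm.rpow_const fun _ _ => Or.inr hp

theorem circleIntegrable_norm_rpow {p : ℝ} (hp : 0 ≤ p) {f : ℂ → ℂ}
    (hf : DifferentiableOn ℂ f (Metric.ball 0 1)) {r : ℝ} (hr : r ∈ Set.Ioo (0 : ℝ) 1) :
    CircleIntegrable (fun z => ‖f z‖ ^ p) 0 r :=
  ((continuousOn_norm_rpow hp hf.continuousOn).mono fun z hz => by
    rw [mem_sphere_zero_iff_norm] at hz
    simpa [hz] using hr.2).circleIntegrable hr.1.le

theorem norm_sub_rpow_le {p : ℝ} (hp : 0 ≤ p) (u v : ℂ) :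
    ‖u - v‖ ^ p ≤ 2 ^ p * (‖u‖ ^ p + ‖v‖ ^ p) := by
  have h1 : ‖u - v‖ ≤ 2 * max ‖u‖ ‖v‖ :=
    (norm_sub_le u v).trans (by linarith [le_max_left ‖u‖ ‖v‖, le_max_right ‖u‖ ‖v‖])
  calc ‖u - v‖ ^ p ≤ (2 * max ‖u‖ ‖v‖) ^ p := by gcongr
    _ = 2 ^ p * max ‖u‖ ‖v‖ ^ p := Real.mul_rpow (by norm_num) (by positivity)
    _ ≤ 2 ^ p * (‖u‖ ^ p + ‖v‖ ^ p) := by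
        gcongr
        rcases max_cases ‖u‖ ‖v‖ with ⟨h, -⟩ | ⟨h, -⟩ <;> rw [h]
        · exact le_add_of_nonneg_right (by positivity)
        · exact le_add_of_nonneg_left (by positivity)

theorem SeriesMemHardy.sub {p : ℝ} (hp : 0 ≤ p) {c d : ℕ → ℂ} (hc : SeriesMemHardy p c)
    (hd : SeriesMemHardy p d) : SeriesMemHardy p fun n => c n - d n := by
  obtain ⟨f, ⟨hf, A, hA⟩, hcf⟩ := hc
  obtain ⟨g, ⟨hg, B, hB⟩, hdg⟩ := hd
  refine ⟨fun z => f z - g z, ⟨hf.sub hg, 2 ^ p * (A + B), fun r hr => ?_⟩, fun z hz => ?_⟩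
  · have If := circleIntegrable_norm_rpow hp hf hr
    have Ig := circleIntegrable_norm_rpow hp hg hr
    calc Real.circleAverage (fun z => ‖f z - g z‖ ^ p) 0 r
        ≤ Real.circleAverage (fun z => (2 ^ p : ℝ) • (‖f z‖ ^ p + ‖g z‖ ^ p)) 0 r :=
          Real.circleAverage_mono (circleIntegrable_norm_rpow hp (hf.sub hg) hr)
            ((If.add Ig).const_smul) fun z _ => norm_sub_rpow_le hp _ _
      _ = 2 ^ p * (Real.circleAverage (fun z => ‖f z‖ ^ p) 0 r
            + Real.circleAverage (fun z => ‖g z‖ ^ p) 0 r) := by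
          rw [Real.circleAverage_fun_smul, Real.circleAverage_fun_add If Ig, smul_eq_mul]
      _ ≤ 2 ^ p * (A + B) := by
          gcongr
          exacts [hA r hr, hB r hr]
  · simpa only [sub_mul] using (hcf z hz).sub (hdg z hz)

theorem SeriesMemHardy.const_mul {p : ℝ} {c : ℕ → ℂ} (hc : SeriesMemHardy p c)
    (k : ℂ) : SeriesMemHardy p fun n => k * c n := by
  obtain ⟨f, ⟨hf, A, hA⟩, hcf⟩ := hc
  refine ⟨fun z => k * f z, ⟨hf.const_mul k, ‖k‖ ^ p * A, fun r hr => ?_⟩, fun z hz => ?_⟩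
  · have : (fun z => ‖k * f z‖ ^ p) = fun z => (‖k‖ ^ p) • ‖f z‖ ^ p := by
      ext z
      rw [norm_mul, Real.mul_rpow (norm_nonneg _) (norm_nonneg _), smul_eq_mul]
    rw [this, Real.circleAverage_fun_smul, smul_eq_mul]
    gcongr
    exact hA r hr
  · simpa only [mul_assoc] using (hcf z hz).mul_left k

/-! ### Integral means of partial sums and square-summable coefficients -/

/-- The integral means of the partial sums converge to those of the sum. -/
theorem tendsto_circleAverage_partialSum {p : ℝ} (hp : 0 ≤ p) {c : ℕ → ℂ} {r : ℝ} (hr : 0 ≤ r)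
    (hc : Summable fun n => ‖c n‖ * r ^ n) :
    Tendsto (fun N => Real.circleAverage (fun z => ‖∑ n ∈ Finset.range N, c n * z ^ n‖ ^ p) 0 r)
      atTop (nhds (Real.circleAverage (fun z => ‖∑' n, c n * z ^ n‖ ^ p) 0 r)) := by
  have hnorm (θ : ℝ) : ‖circleMap 0 r θ‖ ≤ r := by simp [abs_of_nonneg hr]
  simp only [Real.circleAverage_def]
  refine Tendsto.const_smul ?_ _
  refine intervalIntegral.tendsto_integral_filter_of_dominated_convergence
    (fun _ => (∑' n, ‖c n‖ * r ^ n) ^ p) (Eventually.of_forall fun N => ?_)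
    (Eventually.of_forall fun N => Eventually.of_forall fun θ _ => ?_) ?_
    (Eventually.of_forall fun θ _ => ?_)
  · have : Continuous fun z : ℂ => ‖∑ n ∈ Finset.range N, c n * z ^ n‖ ^ p :=
      (by fun_prop : Continuous fun z : ℂ => ‖∑ n ∈ Finset.range N, c n * z ^ n‖).rpow_const
        fun _ => Or.inr hp
    exact (this.comp (continuous_circleMap 0 r)).aestronglyMeasurable
  · rw [Real.norm_of_nonneg (by positivity)]
    gcongr
    calc _ ≤ ∑ n ∈ Finset.range N, ‖c n‖ * r ^ n :=
          norm_sum_le_of_le _ fun n _ => norm_coeff_mul_pow_le (hnorm θ) n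
      _ ≤ _ := hc.sum_le_tsum _ fun n _ => by positivity
  · exact intervalIntegrable_const
  · have hs : Summable fun n => c n * circleMap 0 r θ ^ n :=
      Summable.of_norm_bounded hc (norm_coeff_mul_pow_le (hnorm θ))
    exact (hs.hasSum.tendsto_sum_nat.norm).rpow_const (Or.inr hp)

/-- For polynomials, the means of order `2` are controlled by Parseval's identity. -/
theorem circleAverage_sq_partialSum_le (c : ℕ → ℂ) (N : ℕ) {r : ℝ} (hr : r ∈ Set.Icc (0 : ℝ) 1) :
    Real.circleAverage (fun z => ‖∑ n ∈ Finset.range N, c n * z ^ n‖ ^ (2 : ℝ)) 0 r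
      ≤ ∑ n ∈ Finset.range N, ‖c n‖ ^ 2 := by
  -- Rescale to the unit circle, where the polynomial has coefficients `c n * r ^ n`.
  let q : Polynomial ℂ := ∑ n ∈ Finset.range N, Polynomial.monomial n (c n * (r : ℂ) ^ n)
  have hcoeff (n : ℕ) : q.coeff n = if n < N then c n * (r : ℂ) ^ n else 0 := by
    simp [q, Polynomial.finsetSum_coeff, Polynomial.coeff_monomial]
  have hsupp : q.support ⊆ Finset.range N := by
    intro n hn
    by_contra h
    rw [Finset.mem_range] at h
    exact Polynomial.mem_support_iff.1 hn (by rw [hcoeff, if_neg h])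
  have hval (z : ℂ) : q.eval z = ∑ n ∈ Finset.range N, c n * (r * z) ^ n := by
    simp [q, Polynomial.eval_finsetSum, mul_pow, mul_assoc]
  rw [Real.circleAverage_eq_circleAverage_zero_one]
  calc _ = Real.circleAverage (fun z => ‖q.eval z‖ ^ 2) 0 1 := by
        simp [hval]
    _ = ∑ n ∈ q.support, ‖q.coeff n‖ ^ 2 := (Polynomial.sum_sq_norm_coeff_eq_circleAverage q).symm
    _ ≤ ∑ n ∈ Finset.range N, ‖q.coeff n‖ ^ 2 :=
        Finset.sum_le_sum_of_subset_of_nonneg hsupp fun _ _ _ => by positivity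
    _ ≤ ∑ n ∈ Finset.range N, ‖c n‖ ^ 2 := by
        refine Finset.sum_le_sum fun n hn => ?_
        rw [hcoeff, if_pos (Finset.mem_range.1 hn), norm_mul, norm_pow, Complex.norm_real,
          Real.norm_of_nonneg hr.1]
        exact pow_le_pow_left₀ (mul_nonneg (norm_nonneg _) (pow_nonneg hr.1 n))
          (mul_le_of_le_one_right (norm_nonneg (c n)) (pow_le_one₀ hr.1 hr.2)) 2

theorem seriesMemHardy_two_of_summable_sq {c : ℕ → ℂ} (hc : Summable fun n => ‖c n‖ ^ 2) :
    SeriesMemHardy 2 c := by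
  have hsum : ∀ r ∈ Set.Ioo (0 : ℝ) 1, Summable fun n => ‖c n‖ * r ^ n := by
    intro r hr
    have hg : Summable fun n : ℕ => (r ^ n) ^ 2 := by
      have hr2 : r ^ 2 < 1 := pow_lt_one₀ hr.1.le hr.2 two_ne_zero
      simpa only [pow_right_comm] using summable_geometric_of_lt_one (sq_nonneg r) hr2
    refine Summable.of_nonneg_of_le (fun n => mul_nonneg (norm_nonneg _) (pow_nonneg hr.1.le _))
      (fun n => ?_) (hc.add hg)
    nlinarith [sq_nonneg (‖c n‖ - r ^ n), sq_nonneg ‖c n‖, sq_nonneg (r ^ n)]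
  refine seriesMemHardy_iff.2 ⟨hsum, ∑' n, ‖c n‖ ^ 2, fun r hr => ?_⟩
  refine le_of_tendsto' (tendsto_circleAverage_partialSum (by norm_num) hr.1.le (hsum r hr))
    fun N => ?_
  exact (circleAverage_sq_partialSum_le c N ⟨hr.1.le, hr.2.le⟩).trans
    (hc.sum_le_tsum _ fun n _ => by positivity)

/-! ### Radial growth -/

/-- Growth of `H^p` functions for an integer exponent: Cauchy's formula applied to `f ^ p`. -/
theorem MemHardy.exists_norm_pow_mul_le {p : ℕ} {f : ℂ → ℂ} (hf : MemHardy p f) :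
    ∃ C : ℝ, ∀ r ∈ Set.Ioo (0 : ℝ) 1, ‖f r‖ ^ p * (1 - r) ≤ C := by
  obtain ⟨hd, C, hC⟩ := hf
  refine ⟨2 * C, fun r hr => ?_⟩
  obtain ⟨hr0, hr1⟩ := hr
  set ρ : ℝ := (1 + r) / 2 with hρ
  have hρ0 : 0 < ρ := by positivity
  have hρ1 : ρ < 1 := by rw [hρ]; linarith
  have hrρ : r < ρ := by rw [hρ]; linarith
  have hsub : Metric.closedBall (0 : ℂ) ρ ⊆ Metric.ball 0 1 :=
    Metric.closedBall_subset_ball hρ1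
  have hdc : DiffContOnCl ℂ (fun z => f z ^ p) (Metric.ball 0 |ρ|) := by
    rw [abs_of_pos hρ0]
    exact (hd.fun_pow p).diffContOnCl_ball hsub
  have hw : (r : ℂ) ∈ Metric.ball (0 : ℂ) |ρ| := by
    simpa [abs_of_pos hr0, abs_of_pos hρ0] using hrρ
  have hcauchy := hdc.circleAverage_smul_div hw
  have hint := circleIntegrable_norm_rpow (p := p) (by positivity) hd ⟨hρ0, hρ1⟩
  have hdist : ∀ z ∈ Metric.sphere (0 : ℂ) |ρ|, ‖z‖ = ρ ∧ ρ - r ≤ ‖z - r‖ := by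
    intro z hz
    rw [mem_sphere_zero_iff_norm, abs_of_pos hρ0] at hz
    refine ⟨hz, ?_⟩
    have := norm_sub_norm_le z (r : ℂ)
    rwa [hz, Complex.norm_real, Real.norm_of_nonneg hr0.le] at this
  have key : ‖f r‖ ^ p ≤ (ρ / (ρ - r)) * C := by
    calc ‖f r‖ ^ p = ‖Real.circleAverage
          (fun z => ((z - 0) / (z - (r : ℂ))) • f z ^ p) 0 ρ‖ := by rw [hcauchy, norm_pow]
      _ ≤ Real.circleAverage (fun z => ‖((z - 0) / (z - (r : ℂ))) • f z ^ p‖) 0 ρ := by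
          rw [Real.circleAverage_def, Real.circleAverage_def, norm_smul,
            Real.norm_of_nonneg (by positivity), smul_eq_mul]
          gcongr
          exact intervalIntegral.norm_integral_le_integral_norm Real.two_pi_pos.le
      _ ≤ Real.circleAverage (fun z => (ρ / (ρ - r)) • ‖f z‖ ^ (p : ℝ)) 0 ρ := by
          refine Real.circleAverage_mono ?_ hint.const_smul fun z hz => ?_
          · refine ContinuousOn.circleIntegrable hρ0.le (ContinuousOn.norm ?_)
            refine ContinuousOn.smul (ContinuousOn.div (continuousOn_id.sub continuousOn_const)
              (continuousOn_id.sub continuousOn_const) ?_)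
              ((hd.continuousOn.mono (Metric.sphere_subset_closedBall.trans hsub)).pow p)
            intro z hz h0
            have := (hdist z (by rwa [abs_of_pos hρ0])).2
            rw [show z - (r : ℂ) = 0 from h0, norm_zero] at this
            linarith
          · obtain ⟨h1, h2⟩ := hdist z hz
            rw [sub_zero, norm_smul, norm_div, h1, norm_pow, Real.rpow_natCast, smul_eq_mul]
            have : 0 < ρ - r := by linarith
            gcongr
      _ = (ρ / (ρ - r)) * Real.circleAverage (fun z => ‖f z‖ ^ (p : ℝ)) 0 ρ := by
          rw [Real.circleAverage_fun_smul, smul_eq_mul]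
      _ ≤ (ρ / (ρ - r)) * C := by
          have : 0 < ρ - r := by linarith
          gcongr
          exact hC ρ ⟨hρ0, hρ1⟩
  have hC0 : 0 ≤ C := (Real.circleAverage_nonneg_of_nonneg fun z _ => by positivity).trans
    (hC ρ ⟨hρ0, hρ1⟩)
  have h2 : ρ - r = (1 - r) / 2 := by rw [hρ]; ring
  have h1r : 0 < 1 - r := by linarith
  calc ‖f r‖ ^ p * (1 - r) ≤ (ρ / (ρ - r)) * C * (1 - r) := by gcongr
    _ = 2 * (ρ * C) := by rw [h2]; field_simp
    _ ≤ 2 * C := by gcongr; exact mul_le_of_le_one_left hC0 hρ1.le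

/-! ### Measurability of membership in a Hardy space -/

/-- Membership in `H^p` expressed by countably many conditions on the partial sums of the series;
this is what makes it a measurable property of the coefficients. -/
theorem seriesMemHardy_iff_countable {p : ℝ} (hp : 0 ≤ p) {c : ℕ → ℂ} :
    SeriesMemHardy p c ↔
      (∀ q : ℚ, (q : ℝ) ∈ Set.Ioo (0 : ℝ) 1 → ∃ B : ℕ, ∀ n, ‖c n‖ * (q : ℝ) ^ n ≤ B) ∧
      ∃ C : ℕ, ∀ q : ℚ, (q : ℝ) ∈ Set.Ioo (0 : ℝ) 1 → ∃ M : ℕ, ∀ N : ℕ, M ≤ N →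
        Real.circleAverage (fun z => ‖∑ n ∈ Finset.range N, c n * z ^ n‖ ^ p) 0 q ≤ C := by
  rw [seriesMemHardy_iff]
  constructor
  · rintro ⟨hs, C, hC⟩
    refine ⟨fun q hq => ?_, ?_⟩
    · obtain ⟨B, hB⟩ := exists_nat_ge (∑' n, ‖c n‖ * (q : ℝ) ^ n)
      refine ⟨B, fun n => ((hs q hq).le_tsum n fun m _ => ?_).trans hB⟩
      exact mul_nonneg (norm_nonneg _) (pow_nonneg hq.1.le _)
    · obtain ⟨D, hD⟩ := exists_nat_gt C
      refine ⟨D, fun q hq => ?_⟩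
      have ht := tendsto_circleAverage_partialSum hp hq.1.le (hs q hq)
      obtain ⟨M, hM⟩ := eventually_atTop.1 (ht.eventually_lt_const ((hC q hq).trans_lt hD))
      exact ⟨M, fun N hN => (hM N hN).le⟩
  · rintro ⟨hB, C, hC⟩
    have hs : ∀ r ∈ Set.Ioo (0 : ℝ) 1, Summable fun n => ‖c n‖ * r ^ n := by
      intro r hr
      obtain ⟨q, hrq, hq1⟩ := exists_rat_btwn hr.2
      have hq0 : (0 : ℝ) < q := hr.1.trans hrq
      obtain ⟨B, hB⟩ := hB q ⟨hq0, hq1⟩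
      have hg : Summable fun n : ℕ => (B : ℝ) * (r / q) ^ n :=
        (summable_geometric_of_lt_one (div_nonneg hr.1.le hq0.le)
          ((div_lt_one hq0).2 hrq)).mul_left _
      refine hg.of_nonneg_of_le
        (fun n => mul_nonneg (norm_nonneg _) (pow_nonneg hr.1.le _)) fun n => ?_
      calc ‖c n‖ * r ^ n = (‖c n‖ * (q : ℝ) ^ n) * (r / q) ^ n := by
            rw [div_pow]; field_simp
        _ ≤ B * (r / q) ^ n :=
            mul_le_mul_of_nonneg_right (hB n) (pow_nonneg (div_nonneg hr.1.le hq0.le) _)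
    refine ⟨hs, C, ?_⟩
    -- The integral means depend continuously on the radius, so rational radii suffice.
    have hcont : ContinuousOn
        (Real.circleAverage (fun z => ‖∑' n, c n * z ^ n‖ ^ p) 0) (Set.Ioo 0 1) := by
      refine Real.ContinuousOn.circleAverage ?_ fun r hr => hr.1.le
      refine (continuousOn_norm_rpow hp
        (differentiableOn_tsum_coeff_mul_pow hs).continuousOn).mono fun z hz => ?_
      simpa using hz.2
    by_contra! hcon
    obtain ⟨r, hr, hrC⟩ := hcon
    obtain ⟨q, hqr⟩ := Rat.denseRange_cast (𝕜 := ℝ) |>.exists_mem_open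
      (hcont.isOpen_inter_preimage isOpen_Ioo (isOpen_Ioi (a := (C : ℝ)))) ⟨r, hr, hrC⟩
    obtain ⟨M, hM⟩ := hC q hqr.1
    have := le_of_tendsto (tendsto_circleAverage_partialSum hp hqr.1.1.le (hs q hqr.1))
      (eventually_atTop.2 ⟨M, hM⟩)
    exact absurd hqr.2 (not_lt.2 this)

theorem measurableSet_seriesMemHardy {p : ℝ} (hp : 0 ≤ p) (a : ℕ → ℂ) :
    MeasurableSet {x : ℕ → ℝ | SeriesMemHardy p fun n => a n * (x n : ℂ)} := by
  simp only [seriesMemHardy_iff_countable hp, Set.ofPred_and, Set.ofPred_forall, Set.ofPred_exists]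
  refine MeasurableSet.inter ?_ ?_
  · refine .iInter fun q => .iInter fun _ => .iUnion fun B => .iInter fun n => ?_
    exact measurableSet_le (by fun_prop) measurable_const
  · refine .iUnion fun C => .iInter fun q => .iInter fun _ => .iUnion fun M =>
      .iInter fun N => .iInter fun _ => ?_
    refine measurableSet_le (Continuous.measurable ?_) measurable_const
    have hcont : Continuous fun y : (ℕ → ℝ) × ℝ =>
        ‖∑ n ∈ Finset.range N, a n * (y.1 n : ℂ) * circleMap 0 q y.2 ^ n‖ ^ p :=
      Continuous.rpow_const (by fun_prop) fun _ => Or.inr hp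
    exact (intervalIntegral.continuous_parametric_intervalIntegral_of_continuous'
      (μ := volume) hcont 0 (2 * Real.pi)).const_smul (2 * Real.pi)⁻¹

/-! ### Reflection of a Gaussian process -/

/-- Reflecting a centered Gaussian process across the hyperplane orthogonal to one of its
variables (with respect to the covariance) preserves its law. -/
theorem ProbabilityTheory.IsGaussianProcess.identDistrib_reflection {T Ω : Type*} [Countable T]
    [MeasurableSpace Ω] {P : Measure Ω} {X : T → Ω → ℝ} (hX : IsGaussianProcess X P)
    (hcent : ∀ t, ∫ ω, X t ω ∂P = 0)
    (m : T) (hm : ∫ ω, X m ω * X m ω ∂P ≠ 0) :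
    IdentDistrib (fun ω t => X t ω)
      (fun ω t => X t ω
        - 2 * ((∫ ω, X t ω * X m ω ∂P) / ∫ ω, X m ω * X m ω ∂P) * X m ω) P P := by
  have := hX.isProbabilityMeasure
  set s : ℝ := ∫ ω, X m ω * X m ω ∂P with hs
  set k : T → ℝ := fun t => (∫ ω, X t ω * X m ω ∂P) / s with hk
  have hmeas (t : T) : AEMeasurable (X t) P := hX.aemeasurable t
  have hL2 (t : T) : MemLp (X t) 2 P := (hX.hasGaussianLaw_eval t).memLp_two
  have hY : IsGaussianProcess (fun t ω => X t ω - 2 * k t * X m ω) P := by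
    classical
    refine hX.of_isGaussianProcess fun t => ⟨{t, m},
      .proj ⟨t, by simp⟩ - (2 * k t) • .proj ⟨m, by simp⟩, fun ω => ?_⟩
    simp [mul_assoc]
  refine (identDistrib_iff_forall_finset_identDistrib
    (X := X) (Y := fun t ω => X t ω - 2 * k t * X m ω)
    (aemeasurable_pi_lambda _ hmeas) (aemeasurable_pi_lambda _ hY.aemeasurable)).2 fun I => ?_
  have hXI := hX.hasGaussianLaw I
  have hYI := hY.hasGaussianLaw I
  refine ⟨hXI.aemeasurable, hYI.aemeasurable, ?_⟩
  have := hXI.isGaussian_map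
  have := hYI.isGaussian_map
  -- Both marginals are Gaussian, so equality of means and variances of linear functionals suffices.
  refine Measure.ext_of_charFunDual (funext fun L => ?_)
  -- A functional of the finite-dimensional marginal is a linear combination `U` of the `X t`.
  classical
  let l : I → ℝ := fun i => L (Pi.single i 1)
  let U : Ω → ℝ := fun ω => ∑ i : I, l i * X i ω
  let κ : ℝ := ∑ i : I, l i * k i
  have hLv (v : I → ℝ) : L v = ∑ i, l i * v i := by
    conv_lhs => rw [← Finset.univ_sum_single v, map_sum]
    refine Finset.sum_congr rfl fun i _ => ?_
    rw [← mul_one (v i), ← smul_eq_mul, Pi.single_smul, map_smul]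
    simp [l, mul_comm]
  have hLX : (fun ω => L (I.restrict (X · ω))) = U := by
    ext ω; simp [hLv, U]
  have hLY : (fun ω => L (I.restrict (fun t => X t ω - 2 * k t * X m ω)))
      = fun ω => U ω - 2 * κ * X m ω := by
    ext ω
    simp only [hLv, Finset.restrict_def, U, κ, mul_sub, Finset.sum_sub_distrib,
      Finset.mul_sum, Finset.sum_mul]
    congr 1
    exact Finset.sum_congr rfl fun i _ => by ring
  have hU : MemLp U 2 P := memLp_finsetSum Finset.univ (f := fun (i : I) ω => l i * X i ω)
    fun i _ => (hL2 i).const_mul (l i)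
  have hUmean : ∫ ω, U ω ∂P = 0 := by
    simp only [U]
    rw [integral_finsetSum _ fun (i : I) _ => ((hL2 i).integrable one_le_two).const_mul (l i)]
    simp [integral_const_mul, hcent]
  have hV : MemLp (fun ω => U ω - 2 * κ * X m ω) 2 P := hU.sub ((hL2 m).const_mul _)
  have hVmean : ∫ ω, (U ω - 2 * κ * X m ω) ∂P = 0 := by
    rw [integral_sub (hU.integrable one_le_two) (((hL2 m).integrable one_le_two).const_mul _),
      integral_const_mul, hUmean, hcent]
    simp
  have hUX : ∫ ω, U ω * X m ω ∂P = κ * s := by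
    simp only [U, Finset.sum_mul, κ]
    rw [integral_finsetSum _ fun i _ => by
      simpa only [mul_assoc, Pi.mul_apply] using ((hL2 i).integrable_mul (hL2 m)).const_mul (l i)]
    refine Finset.sum_congr rfl fun i _ => ?_
    simp only [mul_assoc, integral_const_mul, hk]
    rw [div_mul_cancel₀ _ hm]
  have hvar : Var[fun ω => U ω - 2 * κ * X m ω; P] = Var[U; P] := by
    rw [variance_of_integral_eq_zero hV.aemeasurable hVmean,
      variance_of_integral_eq_zero hU.aemeasurable hUmean]
    have i1 : Integrable (fun ω => U ω ^ 2) P := hU.integrable_sq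
    have i2 : Integrable (fun ω => U ω * X m ω) P := hU.integrable_mul (hL2 m)
    have i3 : Integrable (fun ω => X m ω * X m ω) P := (hL2 m).integrable_mul (hL2 m)
    calc ∫ ω, (U ω - 2 * κ * X m ω) ^ 2 ∂P
        = ∫ ω, (U ω ^ 2 - 4 * κ * (U ω * X m ω)) + 4 * κ ^ 2 * (X m ω * X m ω) ∂P := by
          congr 1; ext ω; ring
      _ = (∫ ω, U ω ^ 2 ∂P) - 4 * κ * (κ * s) + 4 * κ ^ 2 * s := by
          rw [integral_add (f := fun ω => U ω ^ 2 - 4 * κ * (U ω * X m ω))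
              (i1.sub (i2.const_mul _)) (i3.const_mul _),
            integral_sub i1 (i2.const_mul _), integral_const_mul, integral_const_mul, hUX]
      _ = ∫ ω, U ω ^ 2 ∂P := by ring
  rw [hXI.charFunDual_map_eq, hYI.charFunDual_map_eq]
  simp only [Function.comp_def, hLX, hLY, hvar, hUmean, hVmean]

/-- If the Gaussian randomization of a series is almost surely in `H^p`, so is its randomization by
the reflected process; the difference of the two is a nonzero multiple of the series whose
coefficients are weighted by the covariances. -/
theorem seriesMemHardy_covariance {Ω : Type*} [MeasurableSpace Ω] {P : Measure Ω}
    {X : ℕ → Ω → ℝ} (hX : IsGaussianProcess X P) (hcent : ∀ n, ∫ ω, X n ω ∂P = 0)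
    {p : ℝ} (hp : 0 ≤ p) {a : ℕ → ℂ} (ha : ∀ᵐ ω ∂P, SeriesMemHardy p fun n => a n * (X n ω : ℂ))
    (m : ℕ) :
    SeriesMemHardy p fun n => a n * ((∫ ω, X n ω * X m ω ∂P : ℝ) : ℂ) := by
  have := hX.isProbabilityMeasure
  have hi : Integrable (fun ω => X m ω * X m ω) P :=
    (hX.hasGaussianLaw_eval m).memLp_two.integrable_mul (hX.hasGaussianLaw_eval m).memLp_two
  by_cases hm : ∫ ω, X m ω * X m ω ∂P = 0
  · -- A variable of variance zero vanishes almost surely.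
    have h0 : X m =ᵐ[P] 0 := by
      have := (integral_eq_zero_iff_of_nonneg (fun ω => mul_self_nonneg (X m ω)) hi).1 hm
      filter_upwards [this] with ω hω using mul_self_eq_zero.1 hω
    have hz (n : ℕ) : ∫ ω, X n ω * X m ω ∂P = 0 := by
      refine integral_eq_zero_of_ae ?_
      filter_upwards [h0] with ω hω
      simp [hω]
    obtain ⟨ω, hω⟩ := ha.exists
    simpa [hz] using hω.const_mul 0
  · have hrefl := (hX.identDistrib_reflection hcent m hm).ae_snd
      (measurableSet_seriesMemHardy hp a) ha
    have hne : ∃ᵐ ω ∂P, X m ω ≠ 0 := fun h => hm <| integral_eq_zero_of_ae <| by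
      filter_upwards [h] with ω hω
      simp [not_not.1 hω]
    obtain ⟨ω, hω, h1, h2⟩ := (hne.and_eventually (ha.and hrefl)).exists
    have h3 := (h1.sub hp h2).const_mul
      (((∫ ω, X m ω * X m ω ∂P : ℝ) : ℂ) / (2 * (X m ω : ℂ)))
    convert h3 using 2 with n
    have hω' : (X m ω : ℂ) ≠ 0 := Complex.ofReal_ne_zero.2 hω
    have hm' : ((∫ ω, X m ω * X m ω ∂P : ℝ) : ℂ) ≠ 0 := Complex.ofReal_ne_zero.2 hm
    push_cast
    generalize ((∫ ω, X m ω * X m ω ∂P : ℝ) : ℂ) = t at *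
    generalize ((∫ ω, X n ω * X m ω ∂P : ℝ) : ℂ) = u at *
    field_simp
    ring

/-! ### Decay of multipliers of decreasing modulus -/

theorem exp_neg_one_le_div_add_one_pow {N : ℕ} (hN : N ≠ 0) :
    Real.exp (-1) ≤ ((N : ℝ) / (N + 1)) ^ N := by
  have hN0 : (0 : ℝ) < N := by positivity
  calc Real.exp (-1) = Real.exp (-(1 / N)) ^ N := by
        rw [← Real.exp_nat_mul]; congr 1; field_simp
    _ ≤ ((N : ℝ) / (N + 1)) ^ N := by
        gcongr
        rw [Real.exp_neg, ← inv_div ((N : ℝ) + 1) N]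
        gcongr
        calc ((N : ℝ) + 1) / N = 1 / N + 1 := by field_simp; ring
          _ ≤ Real.exp (1 / N) := Real.add_one_le_exp _

/-- A multiplier of decreasing modulus from `H^2` to all `H^p` decays almost like `n ^ (-1/2)`. The
series tested has coefficients of modulus `(n + 1) ^ (-1/2 - δ)`, with signs chosen so that the
image has nonnegative coefficients and is as large as possible at the points `N / (N + 1)`. -/
theorem isLittleO_of_isCoeffMultiplier {lam : ℕ → ℝ}
    (hmul : ∀ p : ℝ, 1 ≤ p → IsCoeffMultiplier 2 p fun n => (lam n : ℂ))
    (hanti : Antitone fun n => |lam n|) {ε : ℝ} (hε : 0 < ε) :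
    lam =o[atTop] fun n : ℕ => (n : ℝ) ^ (-(1 / 2 : ℝ) + ε) := by
  -- The exponent loses `δ` to the test coefficients and `1 / k ≤ δ` to the growth in `H^k`, and
  -- `2 * δ < ε`.
  set δ : ℝ := ε / 4 with hδ
  have hδ0 : 0 < δ := by positivity
  obtain ⟨k, hk⟩ := exists_nat_ge (1 / δ)
  have hk0 : (0 : ℝ) < k := (by positivity : 0 < 1 / δ).trans_le hk
  have hk1 : 1 ≤ k := by exact_mod_cast hk0
  have hkδ : 1 / (k : ℝ) ≤ δ := by rwa [one_div_le hk0 hδ0]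
  let b : ℕ → ℝ := fun n => ((n : ℝ) + 1) ^ (-(1 / 2 : ℝ) - δ)
  have hb0 (n : ℕ) : 0 < b n := by positivity
  let a : ℕ → ℂ := fun n => ((SignType.sign (lam n) : ℝ) * b n : ℝ)
  have ha : SeriesMemHardy 2 a := by
    refine seriesMemHardy_two_of_summable_sq ?_
    have hs : Summable fun n : ℕ => ((n + 1 : ℕ) : ℝ) ^ (-(1 : ℝ) - 2 * δ) :=
      (summable_nat_add_iff 1).2 (Real.summable_nat_rpow.2 (by linarith))
    refine hs.of_nonneg_of_le (fun n => by positivity) fun n => ?_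
    have hb2 : b n ^ 2 = ((n + 1 : ℕ) : ℝ) ^ (-(1 : ℝ) - 2 * δ) := by
      simp only [b]
      rw [← Real.rpow_natCast, ← Real.rpow_mul (by positivity)]
      push_cast
      congr 1
      ring
    have hsign : |(SignType.sign (lam n) : ℝ)| ≤ 1 := by
      rcases lt_trichotomy (lam n) 0 with h | h | h <;> simp [h]
    rw [← hb2, Complex.norm_real, norm_mul, Real.norm_eq_abs, Real.norm_of_nonneg (hb0 n).le]
    exact pow_le_pow_left₀ (mul_nonneg (abs_nonneg _) (hb0 n).le)
      (mul_le_of_le_one_left (hb0 n).le hsign) 2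
  obtain ⟨f, hf, hsum⟩ := hmul k (by exact_mod_cast hk1) a ha
  obtain ⟨C, hC⟩ := hf.exists_norm_pow_mul_le
  have hreal (r : ℝ) (hr : r ∈ Set.Ioo (0 : ℝ) 1) :
      HasSum (fun n => b n * |lam n| * r ^ n) (f r).re := by
    have hmem : (r : ℂ) ∈ Metric.ball (0 : ℂ) 1 := by simpa [abs_of_pos hr.1] using hr.2
    convert Complex.hasSum_re (hsum r hmem) using 2 with n
    have : a n * (lam n : ℂ) * (r : ℂ) ^ n = ((b n * |lam n| * r ^ n : ℝ) : ℂ) := by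
      rw [← sign_mul_self (lam n)]
      simp only [a]
      push_cast
      ring
    rw [this, Complex.ofReal_re]
  have hbound : ∀ N : ℕ, N ≠ 0 →
      |lam N| ≤ (Real.exp 1 * |C| ^ (1 / (k : ℝ)) * 2 ^ (2 * δ))
        * (N : ℝ) ^ (-(1 / 2 : ℝ) + 2 * δ) := by
    intro N hN
    have hN0 : (0 : ℝ) < N := by positivity
    have hN1 : (1 : ℝ) ≤ N := by exact_mod_cast Nat.one_le_iff_ne_zero.2 hN
    -- At this radius `1 - r = 1 / M`, while the first `N + 1` powers of `r` are at least `e⁻¹`.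
    set M : ℝ := (N : ℝ) + 1 with hM
    have hM0 : 0 < M := by positivity
    have hM1 : 1 ≤ M := by linarith
    set r : ℝ := N / M with hr
    have hr1 : r < 1 := (div_lt_one hM0).2 (by linarith)
    have hrI : r ∈ Set.Ioo (0 : ℝ) 1 := ⟨by positivity, hr1⟩
    have hlow : M ^ ((1 / 2 : ℝ) - δ) * |lam N| * Real.exp (-1) ≤ ‖f r‖ := by
      calc M ^ ((1 / 2 : ℝ) - δ) * |lam N| * Real.exp (-1)
          = ∑ n ∈ Finset.range (N + 1), b N * |lam N| * Real.exp (-1) := by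
            have : M ^ ((1 / 2 : ℝ) - δ) = M * b N := by
              simp only [b]
              rw [← hM, mul_comm, ← Real.rpow_add_one hM0.ne']
              congr 1
              ring
            rw [this, Finset.sum_const, Finset.card_range, nsmul_eq_mul]
            push_cast
            ring
        _ ≤ ∑ n ∈ Finset.range (N + 1), b n * |lam n| * r ^ n := by
            refine Finset.sum_le_sum fun n hn => ?_
            have hnN : n ≤ N := Nat.lt_succ_iff.1 (Finset.mem_range.1 hn)
            have h1 : b N ≤ b n := Real.rpow_le_rpow_of_nonpos (by positivity)
              (by gcongr) (by linarith)
            have h2 : |lam N| ≤ |lam n| := hanti hnN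
            have h3 : Real.exp (-1) ≤ r ^ n := (exp_neg_one_le_div_add_one_pow hN).trans
              (pow_le_pow_of_le_one hrI.1.le hr1.le hnN)
            have := hb0 n
            gcongr
        _ ≤ (f r).re := sum_le_hasSum _ (fun n _ => mul_nonneg
            (mul_nonneg (hb0 n).le (abs_nonneg _)) (pow_nonneg hrI.1.le n)) (hreal r hrI)
        _ ≤ ‖f r‖ := Complex.re_le_norm _
    have hup : ‖f r‖ ≤ |C| ^ (1 / (k : ℝ)) * M ^ (1 / (k : ℝ)) := by
      have h1r : 1 - r = 1 / M := by rw [hr, hM]; field_simp; ring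
      have h := hC r hrI
      rw [h1r, mul_one_div, div_le_iff₀ hM0] at h
      rw [← Real.mul_rpow (abs_nonneg _) hM0.le, one_div,
        Real.le_rpow_inv_iff_of_pos (norm_nonneg _) (by positivity) hk0, Real.rpow_natCast]
      exact h.trans (by gcongr; exact le_abs_self C)
    have hsplit : M ^ (-(1 / 2 : ℝ) + δ) * M ^ ((1 / 2 : ℝ) - δ) = 1 := by
      rw [← Real.rpow_add hM0]
      simp
    have hexp : Real.exp 1 * Real.exp (-1) = 1 := by rw [← Real.exp_add]; simp
    calc |lam N| = Real.exp 1 * M ^ (-(1 / 2 : ℝ) + δ)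
          * (M ^ ((1 / 2 : ℝ) - δ) * |lam N| * Real.exp (-1)) := by
          linear_combination (-|lam N|) * hsplit
            - |lam N| * (M ^ (-(1 / 2 : ℝ) + δ) * M ^ ((1 / 2 : ℝ) - δ)) * hexp
      _ ≤ Real.exp 1 * M ^ (-(1 / 2 : ℝ) + δ) * (|C| ^ (1 / (k : ℝ)) * M ^ δ) := by
          refine mul_le_mul_of_nonneg_left (hlow.trans (hup.trans ?_)) (by positivity)
          gcongr
      _ = Real.exp 1 * |C| ^ (1 / (k : ℝ)) * (M ^ (-(1 / 2 : ℝ)) * M ^ (2 * δ)) := by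
          rw [Real.rpow_add hM0, two_mul, Real.rpow_add hM0]
          ring
      _ ≤ Real.exp 1 * |C| ^ (1 / (k : ℝ)) * ((N : ℝ) ^ (-(1 / 2 : ℝ)) * (2 * N) ^ (2 * δ)) := by
          have h1 : M ^ (-(1 / 2 : ℝ)) ≤ (N : ℝ) ^ (-(1 / 2 : ℝ)) :=
            Real.rpow_le_rpow_of_nonpos hN0 (by linarith) (by norm_num)
          have h2 : M ≤ 2 * N := by linarith
          gcongr
      _ = _ := by
          rw [Real.mul_rpow (by norm_num) hN0.le, Real.rpow_add hN0]
          ring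
  have hO : lam =O[atTop] fun n : ℕ => (n : ℝ) ^ (-(1 / 2 : ℝ) + 2 * δ) := by
    refine IsBigO.of_bound (Real.exp 1 * |C| ^ (1 / (k : ℝ)) * 2 ^ (2 * δ))
      ((eventually_ne_atTop 0).mono fun N hN => ?_)
    rw [Real.norm_eq_abs, Real.norm_of_nonneg (by positivity)]
    exact hbound N hN
  refine hO.trans_isLittleO ?_
  have h0 : Tendsto (fun n : ℕ => (n : ℝ) ^ (-(2 * δ))) atTop (nhds 0) :=
    (tendsto_rpow_neg_atTop (by positivity)).comp tendsto_natCast_atTop_atTop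
  refine (((isLittleO_one_iff ℝ).2 h0).mul_isBigO
    (isBigO_refl (fun n : ℕ => (n : ℝ) ^ (-(1 / 2 : ℝ) + ε)) atTop)).congr' ?_ (by simp)
  filter_upwards [eventually_gt_atTop 0] with n hn
  rw [← Real.rpow_add (by positivity)]
  congr 1
  rw [hδ]
  ring

/-! ### Covariances as multipliers -/

theorem proposition5p3 {Ω : Type*} [MeasurableSpace Ω] (P : Measure Ω) [IsProbabilityMeasure P]
    (X : ℕ → Ω → ℝ) (hX : IsGaussianProcess X P) (hcent : ∀ n, ∫ ω, X n ω ∂P = 0)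
    (hL : HasLProperty P X) :
    (∀ m : ℕ, ∀ p : ℝ, 1 ≤ p →
      IsCoeffMultiplier 2 p (fun n => ((∫ ω, X n ω * X m ω ∂P : ℝ) : ℂ))) ∧
    (∀ m : ℕ, Antitone (fun n : ℕ => |∫ ω, X n ω * X m ω ∂P|) →
      ∀ ε : ℝ, 0 < ε →
        (fun n : ℕ => ∫ ω, X n ω * X m ω ∂P) =o[atTop]
          (fun n : ℕ => (n : ℝ) ^ (-(1 / 2 : ℝ) + ε))) := by
  have hmul : ∀ m : ℕ, ∀ p : ℝ, 1 ≤ p →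
      IsCoeffMultiplier 2 p (fun n => ((∫ ω, X n ω * X m ω ∂P : ℝ) : ℂ)) := by
    intro m p hp a ha
    have hp0 : 0 < p := one_pos.trans_le hp
    exact seriesMemHardy_covariance hX hcent hp0.le (hL p hp0 a ha) m
  exact ⟨hmul, fun m hanti ε hε => isLittleO_of_isCoeffMultiplier (hmul m) hanti hε⟩
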